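/- Let $0<\alpha<2$ and $\beta>1$, and let $(S_t)_{t\ge 0}$ be the standard symmetric $\alpha$-stable process on a probability space with probability $P$, that is, a real Lévy process (started at $0$, with independent and stationary increments and almost surely càdlàg paths) with $\mathbb{E}[e^{i\xi S_t}]=e^{-t|\xi|^{\alpha}}$ for all $t\ge 0$ and $\xi\in\mathbb{R}$. For $\delta>0$ let $$S_{\delta,t}=S_t-\sum_{0<s\le t}\Delta S_s\,\mathbf 1_{\{|\Delta S_s|\ge\delta\}},\qquad \Delta S_s=S_s-S_{s-},\qquad S_{s-}=\lim_{r\uparrow s}S_r,$$ be the process with its jumps of size at least $\delta$ removed. For integers $n,j\ge 0$ put $$B_{n,j}=\Big\{\sup_{j2^{-2n}<t\le (j+1)2^{-2n}}\big|S_{2^{-\beta n},t}-S_{2^{-\beta n},\,j2^{-2n}}\big|>2^{-n}\Big\}.$$ Then $$\lim_{m\to\infty}P\Big(\bigcup_{n\ge m}\ \bigcup_{0\le j<2^{2n}-1}B_{n,j}\Big)=0.$$ -/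

import Mathlib

open MeasureTheory ProbabilityTheory Filter Topology Set
open scoped NNReal ENNReal

noncomputable section

/-- A function `u : [0, ∞) → ℝ` is càdlàg: right continuous with (finite) left limits. -/
def IsCadlag (u : ℝ≥0 → ℝ) : Prop :=
  ∀ t : ℝ≥0, ContinuousWithinAt u (Ioi t) t ∧ (0 < t → ∃ l : ℝ, Tendsto u (𝓝[<] t) (𝓝 l))

/-- The jump `Δu_t = u_t - u_{t-}`, where `u_{t-}` is the left limit. At `t = 0` the convention of
`Function.leftLim` is `u_{0-} = u_0`, so that there is no jump at time `0`. -/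
def jump (u : ℝ≥0 → ℝ) (t : ℝ≥0) : ℝ := u t - Function.leftLim u t

/-- The set of the times `0 < s ≤ t` with `|Δu_s| ≥ δ`. For a càdlàg `u` and `δ > 0` it is finite. -/
def bigJumpTimes (u : ℝ≥0 → ℝ) (δ : ℝ) (t : ℝ≥0) : Set ℝ≥0 :=
  {s | s ∈ Ioc 0 t ∧ δ ≤ |jump u s|}

/-- The path with its jumps of size at least `δ` removed:
`u_{δ,t} = u_t - ∑_{0 < s ≤ t} Δu_s 1_{|Δu_s| ≥ δ}`. -/
def truncate (u : ℝ≥0 → ℝ) (δ : ℝ) (t : ℝ≥0) : ℝ :=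
  u t - ∑ᶠ s ∈ bigJumpTimes u δ t, jump u s

/-- Real-valued Lévy process: it starts at `0`, has independent and stationary increments, and
almost all of its paths are càdlàg. -/
structure IsLevyProcess {Ω : Type*} [MeasurableSpace Ω] (X : ℝ≥0 → Ω → ℝ) (P : Measure Ω) :
    Prop where
  measurable : ∀ t, Measurable (X t)
  zero : ∀ᵐ ω ∂P, X 0 ω = 0
  indep : HasIndepIncrements X P
  stationary : ∀ s h : ℝ≥0, IdentDistrib (fun ω ↦ X (s + h) ω - X s ω) (X h) P P
  cadlag : ∀ᵐ ω ∂P, IsCadlag fun t ↦ X t ω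

/-- Standard symmetric `α`-stable process: a Lévy process `S` with
`𝔼[exp (i ξ S_t)] = exp (-t |ξ| ^ α)`. -/
structure IsStdSymmetricStable {Ω : Type*} [MeasurableSpace Ω] (α : ℝ) (S : ℝ≥0 → Ω → ℝ)
    (P : Measure Ω) : Prop where
  levy : IsLevyProcess S P
  char_eq : ∀ (t : ℝ≥0) (ξ : ℝ),
    ∫ ω, Complex.exp (Complex.I * ξ * S t ω) ∂P = Real.exp (-(t * |ξ| ^ α))

/-- The event that the supremum over `j / 2 ^ (2 n) < t ≤ (j + 1) / 2 ^ (2 n)` of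
`|S_{δ,t} - S_{δ, j / 2 ^ (2 n)}|`, with `δ = 2 ^ (-β n)`, exceeds `2 ^ (-n)`.
The supremum is taken in `[0, ∞]`. -/
def oscEvent {Ω : Type*} (S : ℝ≥0 → Ω → ℝ) (β : ℝ) (n j : ℕ) : Set Ω :=
  {ω | ENNReal.ofReal ((2 : ℝ) ^ (-(n : ℝ))) <
    ⨆ t ∈ Ioc ((j : ℝ≥0) / 2 ^ (2 * n)) (((j : ℝ≥0) + 1) / 2 ^ (2 * n)),
      ENNReal.ofReal |truncate (fun s ↦ S s ω) ((2 : ℝ) ^ (-(β * n))) t -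
        truncate (fun s ↦ S s ω) ((2 : ℝ) ^ (-(β * n))) ((j : ℝ≥0) / 2 ^ (2 * n))|}

end

/-! On an interval of length `h`, an exponential bound with parameter `l`, where `l * δ ≤ 1`, shows
that the truncated process oscillates by more than `r` with probability at most `2 exp (3 l² δ^(2-α)
h - l r)`. With `h = 4^(-n)`, `δ = 2^(-βn)`, `r = 2^(-n)` and `l = 2^(n(1+ε))` for small `ε`, this
is at most `2 exp (3 - 2^(nε))`, which beats the `4^n` intervals of level `n`. The union bound gives
the tail of a convergent series.

The exponential bound (`measure_lt_iSup_truncate_le`) avoids the Lévy–Itô decomposition. Along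
almost every path, truncated increments are limits of sums of grid increments cut at a level `δ'`
slightly below `δ` (`tendsto_sum_cut`). The cut increments are bounded, independent and symmetric,
with a variance read off the characteristic function, so Doob's maximal inequality controls their
partial sums uniformly in the mesh. -/

/-! ### Cutting a real number, and exponential bounds for sums -/

/-- The function `x ↦ x 1_{|x| < δ}`. -/
noncomputable def cut (δ x : ℝ) : ℝ := {y : ℝ | |y| < δ}.indicator id x

theorem cut_of_lt {δ x : ℝ} (h : |x| < δ) : cut δ x = x := by
  simp [cut, h]

theorem cut_of_le {δ x : ℝ} (h : δ ≤ |x|) : cut δ x = 0 := by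
  simp [cut, h]

theorem cut_neg (δ x : ℝ) : cut δ (-x) = -cut δ x := by
  rcases lt_or_ge |x| δ with h | h
  · rw [cut_of_lt h, cut_of_lt (by simpa using h)]
  · rw [cut_of_le h, cut_of_le (by simpa using h), neg_zero]

theorem abs_cut_le {δ : ℝ} (hδ : 0 ≤ δ) (x : ℝ) : |cut δ x| ≤ δ := by
  rcases lt_or_ge |x| δ with h | h
  · rw [cut_of_lt h]; exact h.le
  · rw [cut_of_le h]; simpa using hδ

@[fun_prop]
theorem measurable_cut (δ : ℝ) : Measurable (cut δ) :=
  measurable_id.indicator (measurableSet_lt (by fun_prop) (by fun_prop))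

/-- The cosine on the right turns a truncated second moment into a value of the characteristic
function. The constant 3 works because `y² / 3 ≤ 1 - cos y` for `|y| ≤ 1`. -/
theorem cut_sq_le {δ : ℝ} (hδ : 0 < δ) (x : ℝ) :
    cut δ x ^ 2 ≤ 3 * δ ^ 2 * (1 - Real.cos (x / δ)) := by
  rcases lt_or_ge |x| δ with h | h
  · rw [cut_of_lt h]
    have hy : |x / δ| ≤ 1 := by
      rw [abs_div, abs_of_pos hδ, div_le_one hδ]; exact h.le
    have h1 := (abs_le.1 (Real.cos_bound hy)).2
    have h2 : |x / δ| ^ 4 ≤ (x / δ) ^ 2 := by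
      rw [← sq_abs (x / δ)]
      exact pow_le_pow_of_le_one (abs_nonneg _) hy (by norm_num)
    have h3 : x ^ 2 = δ ^ 2 * (x / δ) ^ 2 := by field_simp
    rw [h3]
    have h4 : (x / δ) ^ 2 ≤ 3 * (1 - Real.cos (x / δ)) := by nlinarith [sq_nonneg (x / δ)]
    nlinarith [mul_le_mul_of_nonneg_left h4 (sq_nonneg δ)]
  · rw [cut_of_le h]
    have := Real.cos_le_one (x / δ)
    have : 0 ≤ 1 - Real.cos (x / δ) := by linarith
    simp only [ne_eq, OfNat.ofNat_ne_zero, not_false_eq_true, zero_pow]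
    positivity

theorem cosh_le_one_add_sq {x : ℝ} (hx : |x| ≤ 1) : Real.cosh x ≤ 1 + x ^ 2 := by
  have h1 := (abs_le.1 (Real.abs_exp_sub_one_sub_id_le hx)).2
  have h2 := (abs_le.1 (Real.abs_exp_sub_one_sub_id_le (x := -x) (by simpa using hx))).2
  rw [Real.cosh_eq]
  nlinarith

/-- Exponential maximal inequality for partial sums of bounded independent variables with
`𝔼 exp (l Y) ≥ 1`. -/
theorem measure_exists_lt_sum_le {Ω : Type*} [MeasurableSpace Ω] {P : Measure Ω}
    [IsProbabilityMeasure P] {Y : ℕ → Ω → ℝ} (hY : ∀ i, Measurable (Y i)) (hind : iIndepFun Y P)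
    {M l K : ℝ} (hM : ∀ i ω, |Y i ω| ≤ M) (hl : 0 ≤ l)
    (hge : ∀ i, 1 ≤ ∫ ω, Real.exp (l * Y i ω) ∂P) (hle : ∀ i, ∫ ω, Real.exp (l * Y i ω) ∂P ≤ K)
    {r : ℝ} (hr : 0 ≤ r) (N : ℕ) :
    P {ω | ∃ m ≤ N + 1, r < ∑ i ∈ Finset.range m, Y i ω} ≤
      ENNReal.ofReal (K ^ (N + 1) * Real.exp (-(l * r))) := by
  -- `T n` has `n + 1` terms, so times `0, …, N` cover the partial sums of lengths `1, …, N + 1`;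
  -- the empty sum never exceeds `r ≥ 0`.
  set T : ℕ → Ω → ℝ := fun n ω ↦ ∑ i ∈ Finset.range (n + 1), Y i ω with hT
  set f : ℕ → Ω → ℝ := fun n ω ↦ Real.exp (l * T n ω) with hf
  have hYs : ∀ i, StronglyMeasurable (Y i) := fun i ↦ (hY i).stronglyMeasurable
  set F := Filtration.natural Y hYs with hF
  have hTm : ∀ n, Measurable (T n) := fun n ↦ by fun_prop
  have hYF : ∀ n i, i ≤ n → Measurable[F n] (Y i) := fun n i hi ↦
    ((Filtration.stronglyAdapted_natural hYs i).mono (F.mono hi)).measurable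
  have hTF : ∀ n, Measurable[F n] (T n) := fun n ↦
    Finset.measurable_sum _ fun i hi ↦ hYF n i (by simpa [Nat.lt_succ_iff] using hi)
  have hfF : ∀ n, StronglyMeasurable[F n] (f n) := fun n ↦
    (Real.measurable_exp.comp ((hTF n).const_mul l)).stronglyMeasurable
  have hTb : ∀ n ω, |T n ω| ≤ (n + 1) * M := fun n ω ↦ by
    refine (Finset.abs_sum_le_sum_abs _ _).trans ((Finset.sum_le_sum fun i _ ↦ hM i ω).trans ?_)
    simp
  have hint : ∀ n, Integrable (f n) P := fun n ↦ by
    refine Integrable.of_bound (C := Real.exp (l * ((n + 1) * M)))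
      (by fun_prop) (ae_of_all _ fun ω ↦ ?_)
    rw [Real.norm_eq_abs, Real.abs_exp]
    exact Real.exp_le_exp.2 (mul_le_mul_of_nonneg_left ((le_abs_self _).trans (hTb n ω)) hl)
  have hYint : ∀ i, Integrable (fun ω ↦ Real.exp (l * Y i ω)) P := fun i ↦ by
    refine Integrable.of_bound (C := Real.exp (l * M))
      (by fun_prop) (ae_of_all _ fun ω ↦ ?_)
    rw [Real.norm_eq_abs, Real.abs_exp]
    exact Real.exp_le_exp.2 (mul_le_mul_of_nonneg_left ((le_abs_self _).trans (hM i ω)) hl)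
  have hstep : ∀ n, f (n + 1) = f n * fun ω ↦ Real.exp (l * Y (n + 1) ω) := fun n ↦ by
    funext ω
    simp only [hf, hT, Pi.mul_apply]
    rw [Finset.sum_range_succ _ (n + 1), mul_add, Real.exp_add]
  -- Each step multiplies `f` by an independent factor of mean at least 1.
  have hsub : Submartingale f F P := by
    refine submartingale_nat hfF hint fun n ↦ ?_
    have h1 : P[f (n + 1) | F n] =ᵐ[P]
        f n * P[fun ω ↦ Real.exp (l * Y (n + 1) ω) | F n] := by
      rw [hstep n]
      exact condExp_mul_of_stronglyMeasurable_left (hfF n) (hstep n ▸ hint (n + 1)) (hYint _)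
    have h2 : P[fun ω ↦ Real.exp (l * Y (n + 1) ω) | F n] =ᵐ[P]
        fun _ ↦ ∫ ω, Real.exp (l * Y (n + 1) ω) ∂P := by
      refine condExp_indep_eq (hY (n + 1)).comap_le (F.le n) ?_
        (hind.indep_comap_natural_of_lt hYs n.lt_succ_self)
      exact (Real.measurable_exp.comp
        ((comap_measurable (Y (n + 1))).const_mul l)).stronglyMeasurable
    filter_upwards [h1, h2] with ω h1 h2
    rw [h1, Pi.mul_apply, h2]
    exact le_mul_of_one_le_right (Real.exp_pos _).le (hge _)
  have hmean : ∀ n, ∫ ω, f n ω ∂P ≤ K ^ (n + 1) := fun n ↦ by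
    have := hind.mgf_sum (t := l) hY (Finset.range (n + 1))
    simp only [mgf, Finset.sum_apply] at this
    simp only [hf, hT]
    rw [this]
    calc _ ≤ ∏ _i ∈ Finset.range (n + 1), K :=
          Finset.prod_le_prod (fun i _ ↦ zero_le_one.trans (hge i)) fun i _ ↦ hle i
      _ = _ := by simp
  set ε : ℝ≥0 := ⟨Real.exp (l * r), (Real.exp_pos _).le⟩ with hε
  have hmax := maximal_ineq hsub (fun n ω ↦ (Real.exp_pos _).le) (ε := ε) N
  set A := {ω | (ε : ℝ) ≤ (Finset.range (N + 1)).sup' Finset.nonempty_range_add_one fun k ↦ f k ω}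
    with hA
  have hsubset : {ω | ∃ m ≤ N + 1, r < ∑ i ∈ Finset.range m, Y i ω} ⊆ A := by
    rintro ω ⟨m, hm, hlt⟩
    obtain _ | k := m
    · simp at hlt; exact absurd hlt hr.not_gt
    · refine Finset.le_sup'_of_le (fun k ↦ f k ω) (Finset.mem_range.2 (by omega : k < N + 1)) ?_
      exact Real.exp_le_exp.2 (mul_le_mul_of_nonneg_left hlt.le hl)
  have h3 : (ε : ℝ≥0∞) * P A ≤ ENNReal.ofReal (K ^ (N + 1)) := by
    refine hmax.trans (ENNReal.ofReal_le_ofReal ?_)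
    exact (setIntegral_le_integral (hint N) (ae_of_all _ fun ω ↦ (Real.exp_pos _).le)).trans
      (hmean N)
  have hε' : (ε : ℝ≥0∞) = ENNReal.ofReal (Real.exp (l * r)) := by
    rw [ENNReal.ofReal, Real.toNNReal_of_nonneg (Real.exp_pos _).le]
    rfl
  refine (measure_mono hsubset).trans ?_
  have h4 : P A = ENNReal.ofReal (Real.exp (-(l * r))) * ((ε : ℝ≥0∞) * P A) := by
    rw [← mul_assoc, hε', ← ENNReal.ofReal_mul (Real.exp_pos _).le, ← Real.exp_add]
    simp
  rw [h4, mul_comm (K ^ _), ENNReal.ofReal_mul (Real.exp_pos _).le]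
  gcongr

/-! ### Cut increments of the stable process -/

section Stable

variable {Ω : Type*} [MeasurableSpace Ω] {P : Measure Ω} {α : ℝ} {S : ℝ≥0 → Ω → ℝ}

theorem IsStdSymmetricStable.charFun_map (hS : IsStdSymmetricStable α S P) (t : ℝ≥0) (ξ : ℝ) :
    charFun (P.map (S t)) ξ = Real.exp (-(t * |ξ| ^ α)) := by
  rw [charFun_apply_real, integral_map (hS.levy.measurable t).aemeasurable (by fun_prop),
    ← hS.char_eq t ξ]
  congr with ω
  ring_nf

variable [IsProbabilityMeasure P]

theorem IsStdSymmetricStable.map_neg (hS : IsStdSymmetricStable α S P) (t : ℝ≥0) :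
    (P.map (S t)).map (fun x ↦ -x) = P.map (S t) := by
  have := Measure.isProbabilityMeasure_map (μ := P) (hS.levy.measurable t).aemeasurable
  have := Measure.isProbabilityMeasure_map (μ := P.map (S t)) (f := fun x : ℝ ↦ -x)
    (by fun_prop)
  refine Measure.ext_of_charFun ?_
  funext ξ
  have h : charFun ((P.map (S t)).map (fun x ↦ -x)) ξ = charFun (P.map (S t)) (-ξ) := by
    rw [charFun_apply_real, integral_map (by fun_prop) (by fun_prop), charFun_apply_real]
    congr with x
    push_cast
    ring_nf
  rw [h, hS.charFun_map, hS.charFun_map, abs_neg]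

theorem IsStdSymmetricStable.integral_cos (hS : IsStdSymmetricStable α S P) (t : ℝ≥0) (ξ : ℝ) :
    ∫ x, Real.cos (ξ * x) ∂(P.map (S t)) = Real.exp (-(t * |ξ| ^ α)) := by
  have := Measure.isProbabilityMeasure_map (μ := P) (hS.levy.measurable t).aemeasurable
  have h := hS.charFun_map t ξ
  rw [charFun_apply_real] at h
  have hint : Integrable (fun x : ℝ ↦ Complex.exp (ξ * x * Complex.I)) (P.map (S t)) := by
    refine Integrable.of_bound (C := 1) (by fun_prop) (ae_of_all _ fun x ↦ ?_)
    rw [← Complex.ofReal_mul, Complex.norm_exp_ofReal_mul_I]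
  have h2 := congrArg Complex.re h
  rw [Complex.ofReal_re] at h2
  rw [← h2]
  have h3 : ∫ x : ℝ, (Complex.exp (ξ * x * Complex.I)).re ∂(P.map (S t)) =
      (∫ x : ℝ, Complex.exp (ξ * x * Complex.I) ∂(P.map (S t))).re := integral_re hint
  rw [← h3]
  congr with x
  rw [← Complex.ofReal_mul, Complex.exp_ofReal_mul_I_re]

/-- The law is symmetric and `cut δ` is odd. Passing to `cosh` removes the first-order term in `l`.
-/
theorem IsStdSymmetricStable.integral_exp_cut (hS : IsStdSymmetricStable α S P) (t : ℝ≥0)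
    {δ : ℝ} (hδ : 0 ≤ δ) (l : ℝ) :
    ∫ x, Real.exp (l * cut δ x) ∂(P.map (S t)) = ∫ x, Real.cosh (l * cut δ x) ∂(P.map (S t)) := by
  have := Measure.isProbabilityMeasure_map (μ := P) (hS.levy.measurable t).aemeasurable
  have hint : ∀ l : ℝ, Integrable (fun x ↦ Real.exp (l * cut δ x)) (P.map (S t)) := fun l ↦ by
    refine Integrable.of_bound (C := Real.exp (|l| * δ)) (by fun_prop) (ae_of_all _ fun x ↦ ?_)
    rw [Real.norm_eq_abs, Real.abs_exp]
    refine Real.exp_le_exp.2 ((le_abs_self _).trans ?_)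
    rw [abs_mul]
    exact mul_le_mul_of_nonneg_left (abs_cut_le hδ x) (abs_nonneg l)
  have h1 : ∫ x, Real.exp (l * cut δ x) ∂(P.map (S t)) =
      ∫ x, Real.exp (-l * cut δ x) ∂(P.map (S t)) := by
    conv_lhs => rw [← hS.map_neg t]
    rw [integral_map (by fun_prop) (by fun_prop)]
    simp [cut_neg]
  simp_rw [Real.cosh_eq, ← neg_mul]
  rw [integral_div, integral_add (hint l) (hint (-l)), ← h1]
  ring

/-- After symmetrisation, `1 ≤ cosh` gives the lower bound. For the upper one, `cosh y ≤ 1 + y²` and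
`cut_sq_le` leave `3 l² δ² (1 - 𝔼 cos (S_t / δ))`, and the last factor is `1 - exp (-t δ^(-α)) ≤ t
δ^(-α)`. -/
theorem IsStdSymmetricStable.one_le_integral_exp_cut (hS : IsStdSymmetricStable α S P) (t : ℝ≥0)
    {δ l : ℝ} (hδ : 0 < δ) (hl : |l| * δ ≤ 1) :
    1 ≤ ∫ x, Real.exp (l * cut δ x) ∂(P.map (S t)) ∧
    ∫ x, Real.exp (l * cut δ x) ∂(P.map (S t)) ≤ Real.exp (3 * l ^ 2 * δ ^ (2 - α) * t) := by
  have := Measure.isProbabilityMeasure_map (μ := P) (hS.levy.measurable t).aemeasurable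
  rw [hS.integral_exp_cut t hδ.le]
  have hle : ∀ x, |l * cut δ x| ≤ 1 := fun x ↦ by
    rw [abs_mul]
    exact (mul_le_mul_of_nonneg_left (abs_cut_le hδ.le x) (abs_nonneg l)).trans hl
  have hle2 : ∀ x, Real.cosh (l * cut δ x) ≤
      1 + 3 * l ^ 2 * δ ^ 2 * (1 - Real.cos (δ⁻¹ * x)) := fun x ↦ by
    refine (cosh_le_one_add_sq (hle x)).trans ?_
    have := mul_le_mul_of_nonneg_left (cut_sq_le hδ x) (sq_nonneg l)
    rw [mul_pow, ← div_eq_inv_mul]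
    linarith
  have hc : Integrable (fun x ↦ Real.cos (δ⁻¹ * x)) (P.map (S t)) :=
    Integrable.of_bound (C := 1) (by fun_prop) (ae_of_all _ fun x ↦ Real.abs_cos_le_one _)
  have hcosh : Integrable (fun x ↦ Real.cosh (l * cut δ x)) (P.map (S t)) := by
    refine Integrable.of_bound (C := 2) (by fun_prop) (ae_of_all _ fun x ↦ ?_)
    rw [Real.norm_eq_abs, abs_of_pos (Real.cosh_pos _)]
    refine (cosh_le_one_add_sq (hle x)).trans ?_
    have := (sq_le_one_iff_abs_le_one _).2 (hle x)
    linarith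
  constructor
  · calc (1 : ℝ) = ∫ _, (1 : ℝ) ∂(P.map (S t)) := by simp
      _ ≤ _ := integral_mono (by fun_prop) hcosh fun x ↦ Real.one_le_cosh _
  · calc _ ≤ ∫ x, (1 + 3 * l ^ 2 * δ ^ 2 * (1 - Real.cos (δ⁻¹ * x))) ∂(P.map (S t)) :=
          integral_mono hcosh (by fun_prop) hle2
      _ = 1 + 3 * l ^ 2 * δ ^ 2 * (1 - Real.exp (-(t * |δ⁻¹| ^ α))) := by
          rw [integral_add (by fun_prop) (by fun_prop), integral_const_mul,
            integral_sub (by fun_prop) hc, hS.integral_cos]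
          simp
      _ ≤ 1 + 3 * l ^ 2 * δ ^ 2 * (t * |δ⁻¹| ^ α) := by
          have := Real.add_one_le_exp (-(t * |δ⁻¹| ^ α))
          gcongr
          linarith
      _ = 3 * l ^ 2 * δ ^ (2 - α) * t + 1 := by
          rw [abs_of_pos (by positivity), Real.inv_rpow hδ.le, Real.rpow_sub hδ]
          norm_num
          ring
      _ ≤ _ := Real.add_one_le_exp _

theorem IsStdSymmetricStable.measure_exists_lt_abs_sum_cut_le (hS : IsStdSymmetricStable α S P)
    (a d : ℝ≥0) {δ l r : ℝ} (hδ : 0 < δ) (hl0 : 0 ≤ l) (hl : l * δ ≤ 1) (hr : 0 ≤ r) (N : ℕ) :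
    P {ω | ∃ m ≤ N + 1, r < |∑ i ∈ Finset.range m,
        cut δ (S (a + (i + 1 : ℕ) * d) ω - S (a + i * d) ω)|} ≤
      2 * ENNReal.ofReal
        (Real.exp (3 * l ^ 2 * δ ^ (2 - α) * ((N + 1 : ℕ) * d : ℝ≥0) - l * r)) := by
  set X : ℕ → Ω → ℝ := fun i ω ↦ S (a + (i + 1 : ℕ) * d) ω - S (a + i * d) ω with hX
  have hSm := hS.levy.measurable
  have hXm : ∀ i, Measurable (X i) := fun i ↦ (hSm _).sub (hSm _)
  have hmono : Monotone fun i : ℕ ↦ a + i * d := fun i j hij ↦ by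
    have : (i : ℝ≥0) ≤ j := by exact_mod_cast hij
    dsimp only
    gcongr
  have hXind : iIndepFun X P := hS.levy.indep.nat hmono
  have hXmap : ∀ i, P.map (X i) = P.map (S d) := fun i ↦ by
    have := (hS.levy.stationary (a + i * d) d).map_eq
    rw [← this]
    congr 1
    funext ω
    simp only [hX]
    push_cast
    ring_nf
  -- The signs `σ = ±1` give the two one-sided bounds, whence the factor 2.
  have key : ∀ σ : ℝ, |σ| = 1 →
      P {ω | ∃ m ≤ N + 1, r < ∑ i ∈ Finset.range m, σ * cut δ (X i ω)} ≤ ENNReal.ofReal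
        (Real.exp (3 * l ^ 2 * δ ^ (2 - α) * ((N + 1 : ℕ) * d : ℝ≥0) - l * r)) := by
    intro σ hσ
    have hσ2 : σ ^ 2 = 1 := by rw [← sq_abs, hσ, one_pow]
    have hmean : ∀ i, ∫ ω, Real.exp (l * (σ * cut δ (X i ω))) ∂P =
        ∫ x, Real.exp (l * σ * cut δ x) ∂(P.map (S d)) := fun i ↦ by
      rw [← hXmap i, integral_map (hXm i).aemeasurable (by fun_prop)]
      simp_rw [mul_assoc]
    have hb := hS.one_le_integral_exp_cut d (l := l * σ) hδ
      (by rw [abs_mul, hσ, mul_one, abs_of_nonneg hl0]; exact hl)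
    have := measure_exists_lt_sum_le (Y := fun i ω ↦ σ * cut δ (X i ω)) (P := P) (M := δ)
      (K := Real.exp (3 * (l * σ) ^ 2 * δ ^ (2 - α) * d))
      (fun i ↦ by fun_prop)
      (hXind.comp (fun _ x ↦ σ * cut δ x) (fun _ ↦ by fun_prop))
      (fun i ω ↦ by rw [abs_mul, hσ, one_mul]; exact abs_cut_le hδ.le _) hl0
      (fun i ↦ (hmean i).symm ▸ hb.1) (fun i ↦ (hmean i).symm ▸ hb.2) hr N
    refine this.trans (le_of_eq ?_)
    rw [← Real.exp_nat_mul, ← Real.exp_add, mul_pow, hσ2]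
    congr 2
    push_cast
    ring
  have hsub : {ω | ∃ m ≤ N + 1, r < |∑ i ∈ Finset.range m, cut δ (X i ω)|} ⊆
      {ω | ∃ m ≤ N + 1, r < ∑ i ∈ Finset.range m, 1 * cut δ (X i ω)} ∪
      {ω | ∃ m ≤ N + 1, r < ∑ i ∈ Finset.range m, -1 * cut δ (X i ω)} := by
    rintro ω ⟨m, hm, h⟩
    rcases lt_abs.1 h with h | h
    · exact Or.inl ⟨m, hm, by simpa using h⟩
    · exact Or.inr ⟨m, hm, by simpa using h⟩
  refine (measure_mono hsub).trans ((measure_union_le _ _).trans ?_)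
  rw [two_mul]
  exact add_le_add (key 1 (by simp)) (key (-1) (by simp))

end Stable

/-! ### Jumps and small increments of càdlàg paths -/

theorem NNReal.eventually_coe_lt_nhdsGT {η : ℝ} (hη : 0 < η) :
    ∀ᶠ d : ℝ≥0 in 𝓝[>] 0, (d : ℝ) < η := by
  filter_upwards [mem_nhdsWithin_of_mem_nhds (Metric.ball_mem_nhds 0 hη)] with d hd
  simpa [Metric.mem_ball, NNReal.dist_eq] using hd

namespace IsCadlag

variable {u : ℝ≥0 → ℝ}

theorem tendsto_right (hu : IsCadlag u) (x : ℝ≥0) : Tendsto u (𝓝[≥] x) (𝓝 (u x)) :=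
  continuousWithinAt_Ioi_iff_Ici.1 (hu x).1

theorem tendsto_left (hu : IsCadlag u) (x : ℝ≥0) :
    Tendsto u (𝓝[<] x) (𝓝 (u x - jump u x)) := by
  rcases eq_zero_or_pos x with rfl | hx
  · have : Iio (0 : ℝ≥0) = ∅ := by ext; simp
    simp
  · obtain ⟨y, hy⟩ := (hu x).2 hx
    have : (𝓝[<] x).NeBot := nhdsLT_neBot_of_exists_lt ⟨0, hx⟩
    rw [jump, leftLim_eq_of_tendsto hy]
    simpa using hy

theorem jump_zero : jump u 0 = 0 := by
  rw [jump, leftLim_eq_of_eq_bot _ (by simp), sub_self]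

/-- Near `x` the path is close to `u x` on the right and to its left limit on the left, so only an
interval straddling `x` sees the jump. -/
theorem eventually_increment (hu : IsCadlag u) (x : ℝ≥0) {ε : ℝ} (hε : 0 < ε) :
    ∃ U ∈ 𝓝 x, ∀ s ∈ U, ∀ t ∈ U, s < t →
      |u t - u s - if s < x ∧ x ≤ t then jump u x else 0| < ε := by
  have hr := (Metric.tendsto_nhds.1 (hu.tendsto_right x)) (ε / 2) (by positivity)
  have hl := (Metric.tendsto_nhds.1 (hu.tendsto_left x)) (ε / 2) (by positivity)
  rw [eventually_nhdsWithin_iff] at hr hl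
  refine ⟨_, hr.and hl, ?_⟩
  rintro s ⟨hs1, hs2⟩ t ⟨ht1, ht2⟩ hst
  simp only [mem_Ici, mem_Iio, Real.dist_eq, abs_lt] at hs1 hs2 ht1 ht2
  rw [abs_lt]
  split_ifs with h
  · have := hs2 h.1
    have := ht1 h.2
    constructor <;> linarith
  · rcases lt_or_ge s x with h1 | h1
    · have := hs2 h1
      have := ht2 (lt_of_not_ge fun h' ↦ h ⟨h1, h'⟩)
      constructor <;> linarith
    · have := hs1 h1
      have := ht1 (h1.trans hst.le)
      constructor <;> linarith

theorem eventually_abs_jump_lt (hu : IsCadlag u) (x : ℝ≥0) {ε : ℝ} (hε : 0 < ε) :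
    ∀ᶠ y in 𝓝[≠] x, |jump u y| < ε := by
  obtain ⟨U, hU, h⟩ := hu.eventually_increment x (half_pos hε)
  have hU' := eventually_nhdsWithin_of_eventually_nhds (s := {x}ᶜ) (eventually_mem_nhds_iff.2 hU)
  filter_upwards [hU', self_mem_nhdsWithin] with y hy hyx
  rcases eq_zero_or_pos y with rfl | hy0
  · simpa [jump_zero] using hε
  have : (𝓝[<] y).NeBot := nhdsLT_neBot_of_exists_lt ⟨0, hy0⟩
  have hlim : Tendsto (fun s ↦ |u y - u s|) (𝓝[<] y) (𝓝 |jump u y|) := by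
    have := ((tendsto_const_nhds (x := u y)).sub (hu.tendsto_left y)).abs
    simpa using this
  refine (le_of_tendsto hlim ?_).trans_lt (half_lt_self hε)
  have hne : ∀ᶠ s in 𝓝[<] y, ¬ (s < x ∧ x ≤ y) := by
    rcases lt_or_gt_of_ne (Set.mem_compl_singleton_iff.1 hyx) with h1 | h1
    · exact Eventually.of_forall fun s h2 ↦ h2.2.not_gt h1
    · filter_upwards [mem_nhdsWithin_of_mem_nhds (lt_mem_nhds h1)] with s hs h2
      exact hs.not_gt h2.1
  filter_upwards [hne, mem_nhdsWithin_of_mem_nhds hy, self_mem_nhdsWithin] with s h1 h2 h3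
  have := h s h2 y (mem_of_mem_nhds hy) h3
  rw [if_neg h1, sub_zero] at this
  exact this.le

theorem finite_jumps (hu : IsCadlag u) (b : ℝ≥0) {δ : ℝ} (hδ : 0 < δ) :
    {x | x ≤ b ∧ δ ≤ |jump u x|}.Finite := by
  by_contra hinf
  obtain ⟨x, -, hx⟩ := Set.Infinite.exists_accPt_of_subset_isCompact hinf
    (isCompact_Icc (a := (0 : ℝ≥0)) (b := b)) fun y hy ↦ ⟨zero_le, hy.1⟩
  rw [accPt_iff_frequently_nhdsNE] at hx
  obtain ⟨y, h1, h2⟩ := (hx.and_eventually (hu.eventually_abs_jump_lt x hδ)).exists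
  exact h2.not_ge h1.2

/-- Only finitely many jumps up to `b` have size at least `δ / 2`, so those below `δ` stay away from
`δ`. -/
theorem eventually_abs_jump_lt_of_lt (hu : IsCadlag u) (b : ℝ≥0) {δ : ℝ} (hδ : 0 < δ) :
    ∀ᶠ δ' in 𝓝[<] δ, ∀ x ≤ b, |jump u x| < δ → |jump u x| < δ' := by
  have hF := hu.finite_jumps b (half_pos hδ)
  have h1 : ∀ᶠ δ' in 𝓝[<] δ, ∀ x ∈ {x | x ≤ b ∧ δ / 2 ≤ |jump u x|},
      |jump u x| < δ → |jump u x| < δ' := by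
    refine (eventually_all_finite hF).2 fun x _ ↦ ?_
    by_cases hx : |jump u x| < δ
    · filter_upwards [mem_nhdsWithin_of_mem_nhds (lt_mem_nhds hx)] with δ' h _ using h
    · exact Eventually.of_forall fun _ h ↦ absurd h hx
  filter_upwards [h1, mem_nhdsWithin_of_mem_nhds (lt_mem_nhds (half_lt_self hδ))]
    with δ' h2 h3 x hx hxδ
  rcases lt_or_ge |jump u x| (δ / 2) with h | h
  · exact h.trans h3
  · exact h2 x ⟨hx, h⟩ hxδ

/-- Over short intervals without a jump of size at least `δ`, the increments of a càdlàg function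
whose other jumps are smaller than `δ'` are smaller than `δ'`. -/
theorem eventually_abs_increment_lt (hu : IsCadlag u) (b : ℝ≥0) {δ δ' : ℝ} (hδ' : 0 < δ')
    (hJ : ∀ x ≤ b, |jump u x| < δ → |jump u x| < δ') :
    ∀ᶠ d in 𝓝[>] (0 : ℝ≥0), ∀ s ≤ b, (∀ x ∈ Ioc s (s + d), |jump u x| < δ) →
      |u (s + d) - u s| < δ' := by
  have hU : ∀ x ∈ Icc 0 b, ∃ U ∈ 𝓝 x, ∀ s ∈ U, ∀ t ∈ U, s < t →
      (∀ y ∈ Ioc s t, |jump u y| < δ) → |u t - u s| < δ' := by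
    intro x hx
    -- A small jump at `x` leaves the margin `δ' - |jump u x|`; around a large one, the assumption
    -- on the interval forbids straddling `x`. A Lebesgue number makes the choice uniform.
    by_cases hxδ : |jump u x| < δ
    · obtain ⟨U, hU, h⟩ := hu.eventually_increment x (sub_pos.2 (hJ x hx.2 hxδ))
      refine ⟨U, hU, fun s hs t ht hst _ ↦ ?_⟩
      have h1 := h s hs t ht hst
      have h2 : |if s < x ∧ x ≤ t then jump u x else 0| ≤ |jump u x| := by
        split_ifs <;> simp
      have h3 := abs_sub_abs_le_abs_sub (u t - u s) (if s < x ∧ x ≤ t then jump u x else 0)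
      linarith
    · obtain ⟨U, hU, h⟩ := hu.eventually_increment x hδ'
      refine ⟨U, hU, fun s hs t ht hst hy ↦ ?_⟩
      have h1 := h s hs t ht hst
      have h2 : ¬ (s < x ∧ x ≤ t) := fun h2 ↦ hxδ (hy x h2)
      rwa [if_neg h2, sub_zero] at h1
  choose U hU hUs using hU
  obtain ⟨η, hη, hη'⟩ := Metric.uniformity_basis_dist.lebesgue_number_lemma_nhds'
    (isCompact_Icc (a := 0) (b := b)) hU
  have hd := NNReal.eventually_coe_lt_nhdsGT hη
  filter_upwards [hd, self_mem_nhdsWithin] with d hd hd0 s hs hno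
  obtain ⟨⟨x, hx⟩, hsub⟩ := hη' s ⟨zero_le, hs⟩
  have h1 : dist s s < η := by simpa using hη
  have h2 : dist s (s + d) < η := by simpa [NNReal.dist_eq] using hd
  exact hUs x hx s (hsub h1) (s + d) (hsub h2) (lt_add_of_pos_right s hd0) hno

theorem eventually_abs_increment_sub_jump_lt (hu : IsCadlag u) (x : ℝ≥0) {ε : ℝ} (hε : 0 < ε) :
    ∀ᶠ d in 𝓝[>] (0 : ℝ≥0), ∀ s, s < x → x ≤ s + d → |u (s + d) - u s - jump u x| < ε := by
  obtain ⟨U, hU, h⟩ := hu.eventually_increment x hε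
  obtain ⟨η, hη, hball⟩ := Metric.mem_nhds_iff.1 hU
  have hd := NNReal.eventually_coe_lt_nhdsGT hη
  filter_upwards [hd, self_mem_nhdsWithin] with d hd hd0 s hs hsd
  have hs' : (s : ℝ) < x := hs
  have hsd' : (x : ℝ) ≤ s + d := by exact_mod_cast hsd
  have := h s (hball ?_) (s + d) (hball ?_) (lt_add_of_pos_right s hd0)
  · rwa [if_pos ⟨hs, hsd⟩] at this
  · rw [Metric.mem_ball, NNReal.dist_eq, abs_lt]
    constructor <;> linarith
  · rw [Metric.mem_ball, NNReal.dist_eq, abs_lt]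
    push_cast
    constructor <;> linarith

theorem truncate_sub_truncate (hu : IsCadlag u) (a c : ℝ≥0) {δ : ℝ} (hδ : 0 < δ)
    {J : Finset ℝ≥0} (hJ : ∀ x, x ∈ J ↔ x ∈ Ioc a (a + c) ∧ δ ≤ |jump u x|) :
    truncate u δ (a + c) - truncate u δ a = u (a + c) - u a - ∑ x ∈ J, jump u x := by
  have hfin : (bigJumpTimes u δ a).Finite :=
    (hu.finite_jumps a hδ).subset fun x hx ↦ ⟨hx.1.2, hx.2⟩
  have hunion : bigJumpTimes u δ (a + c) = bigJumpTimes u δ a ∪ J := by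
    ext x
    simp only [bigJumpTimes, mem_ofPred_eq, mem_union, Finset.mem_coe, hJ, mem_Ioc]
    constructor
    · rintro ⟨⟨h1, h2⟩, h3⟩
      rcases le_or_gt x a with h | h
      · exact Or.inl ⟨⟨h1, h⟩, h3⟩
      · exact Or.inr ⟨⟨h, h2⟩, h3⟩
    · rintro (⟨⟨h1, h2⟩, h3⟩ | ⟨⟨h1, h2⟩, h3⟩)
      · exact ⟨⟨h1, h2.trans le_self_add⟩, h3⟩
      · exact ⟨⟨zero_le.trans_lt h1, h2⟩, h3⟩
  have hdisj : Disjoint (bigJumpTimes u δ a) (J : Set ℝ≥0) := by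
    rw [Set.disjoint_left]
    intro x hx hxJ
    exact (((hJ x).1 hxJ).1.1).not_ge hx.1.2
  rw [truncate, truncate, hunion, finsum_mem_union hdisj hfin J.finite_toSet,
    finsum_mem_coe_finset]
  ring

end IsCadlag

theorem NNReal.ceil_div_mul_spec {c d : ℝ≥0} (hd : 0 < d) :
    c ≤ ⌈c / d⌉₊ * d ∧ ⌈c / d⌉₊ * d < c + d ∧ ∀ i < ⌈c / d⌉₊, i * d < c := by
  refine ⟨?_, ?_, fun i hi ↦ ?_⟩
  · rw [← div_le_iff₀ hd]; exact Nat.le_ceil _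
  · have h := Nat.ceil_lt_add_one ((zero_le : 0 ≤ c / d))
    calc _ < (c / d + 1) * d := by gcongr
      _ = _ := by rw [add_mul, div_mul_cancel₀ _ hd.ne', one_mul]
  · rw [← lt_div_iff₀ hd]; exact Nat.lt_ceil.1 hi

/-- For a fine mesh, a grid cell containing a jump of size at least `δ` has an increment of size at
least `δ'` and is cut to 0; every other cell has an increment below `δ'` and is kept. Taking `δ' <
δ` is what handles jumps of size exactly `δ`, whose cells may have slightly smaller increments. -/
theorem IsCadlag.tendsto_sum_cut {u : ℝ≥0 → ℝ} (hu : IsCadlag u) (a c : ℝ≥0) {δ : ℝ}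
    (hδ : 0 < δ) :
    ∀ᶠ δ' in 𝓝[<] δ, Tendsto (fun d : ℝ≥0 ↦ ∑ i ∈ Finset.range ⌈c / d⌉₊,
      cut δ' (u (a + (i + 1 : ℕ) * d) - u (a + i * d))) (𝓝[>] 0)
      (𝓝 (truncate u δ (a + c) - truncate u δ a)) := by
  classical
  have hfin : {x | x ∈ Ioc a (a + c) ∧ δ ≤ |jump u x|}.Finite :=
    (hu.finite_jumps (a + c) hδ).subset fun x hx ↦ ⟨hx.1.2, hx.2⟩
  obtain ⟨J, hJ'⟩ := hfin.exists_finset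
  have hJ : ∀ x, x ∈ J ↔ x ∈ Ioc a (a + c) ∧ δ ≤ |jump u x| := fun x ↦ by rw [hJ']; rfl
  rw [hu.truncate_sub_truncate a c hδ hJ]
  filter_upwards [hu.eventually_abs_jump_lt_of_lt (a + c) hδ, self_mem_nhdsWithin,
    mem_nhdsWithin_of_mem_nhds (lt_mem_nhds hδ)] with δ' hsmall hlt hpos
  simp only [mem_Iio] at hlt
  have hpos : 0 < δ' := hpos
  have hmod := hu.eventually_abs_increment_lt (a + c) hpos hsmall
  have hbig : ∀ᶠ d in 𝓝[>] (0 : ℝ≥0), ∀ x ∈ J, ∀ s, s < x → x ≤ s + d →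
      δ' ≤ |u (s + d) - u s| := by
    refine (eventually_all_finset J).2 fun x hx ↦ ?_
    filter_upwards [hu.eventually_abs_increment_sub_jump_lt x (sub_pos.2 hlt)] with d hd s h1 h2
    have h3 := hd s h1 h2
    have h4 := abs_sub_abs_le_abs_sub (jump u x) (u (s + d) - u s)
    rw [abs_sub_comm (jump u x)] at h4
    have := ((hJ x).1 hx).2
    linarith
  have hsep : ∀ᶠ d in 𝓝[>] (0 : ℝ≥0), ∀ x ∈ J, ∀ y ∈ J, ∀ s, s < x → x ≤ s + d →
      s < y → y ≤ s + d → x = y := by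
    refine (eventually_all_finset J).2 fun x _ ↦ (eventually_all_finset J).2 fun y _ ↦ ?_
    by_cases hxy : x = y
    · exact Eventually.of_forall fun _ _ _ _ _ _ ↦ hxy
    · filter_upwards [NNReal.eventually_coe_lt_nhdsGT (dist_pos.2 hxy)] with d hd s h1 h2 h3 h4
      rw [NNReal.dist_eq] at hd
      have h1 : (s : ℝ) < x := h1
      have h3 : (s : ℝ) < y := h3
      have h2 : (x : ℝ) ≤ s + d := by exact_mod_cast h2
      have h4 : (y : ℝ) ≤ s + d := by exact_mod_cast h4
      rcases lt_abs.1 hd with h | h <;> linarith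
  -- The last grid cell may overrun `a + c`, but it meets no large jump there.
  have hafter : ∀ᶠ d in 𝓝[>] (0 : ℝ≥0), ∀ x ∈ Ioc (a + c) (a + c + d), |jump u x| < δ := by
    have h1 := hu.eventually_abs_jump_lt (a + c) hδ
    rw [eventually_nhdsWithin_iff, Metric.eventually_nhds_iff] at h1
    obtain ⟨η, hη, h1⟩ := h1
    have hd := NNReal.eventually_coe_lt_nhdsGT hη
    filter_upwards [hd] with d hd x hx
    refine h1 ?_ (ne_of_gt hx.1)
    have h2 : ((a + c : ℝ≥0) : ℝ) < x := hx.1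
    have h3 : (x : ℝ) ≤ (a + c : ℝ≥0) + d := by exact_mod_cast hx.2
    rw [NNReal.dist_eq, abs_of_pos (by linarith)]
    linarith
  have hend : Tendsto (fun d : ℝ≥0 ↦ u (a + ⌈c / d⌉₊ * d)) (𝓝[>] 0) (𝓝 (u (a + c))) := by
    refine (hu.tendsto_right (a + c)).comp (tendsto_nhdsWithin_iff.2 ⟨?_, ?_⟩)
    · refine tendsto_of_tendsto_of_tendsto_of_le_of_le' tendsto_const_nhds
        (h := fun d ↦ a + c + d) ?_ ?_ ?_
      · exact (Continuous.tendsto' (by fun_prop) 0 _ (by simp)).mono_left nhdsWithin_le_nhds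
      · filter_upwards [self_mem_nhdsWithin] with d hd
        gcongr
        exact (NNReal.ceil_div_mul_spec hd).1
      · filter_upwards [self_mem_nhdsWithin] with d hd
        rw [add_assoc]
        gcongr
        exact (NNReal.ceil_div_mul_spec hd).2.1.le
    · filter_upwards [self_mem_nhdsWithin] with d hd
      have := (NNReal.ceil_div_mul_spec (c := c) hd).1
      simp only [mem_Ici]
      gcongr
  set D : ℝ≥0 → ℕ → ℝ := fun d i ↦ u (a + (i + 1 : ℕ) * d) - u (a + i * d) with hD
  have hnext : ∀ (d : ℝ≥0) (i : ℕ), a + (i + 1 : ℕ) * d = a + i * d + d := fun d i ↦ by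
    push_cast; ring
  have hjump : ∀ x ∈ J, Tendsto (fun d : ℝ≥0 ↦ ∑ i ∈ Finset.range ⌈c / d⌉₊,
      if a + i * d < x ∧ x ≤ a + (i + 1 : ℕ) * d then D d i else 0) (𝓝[>] 0)
      (𝓝 (jump u x)) := by
    intro x hx
    have hxm := ((hJ x).1 hx).1
    refine Metric.tendsto_nhds.2 fun ε hε ↦ ?_
    filter_upwards [hu.eventually_abs_increment_sub_jump_lt x hε, self_mem_nhdsWithin]
      with d hd (hd0 : 0 < d)
    have hmonot : ∀ i j : ℕ, i ≤ j → a + i * d ≤ a + j * d := fun i j hij ↦ by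
      have : (i : ℝ≥0) ≤ j := by exact_mod_cast hij
      gcongr
    -- The first grid point at or beyond `x` is the right end of the only cell containing `x`.
    have hex : ∃ k : ℕ, x ≤ a + k * d :=
      ⟨⌈c / d⌉₊, hxm.2.trans (by gcongr; exact (NNReal.ceil_div_mul_spec hd0).1)⟩
    obtain ⟨k, hk⟩ : ∃ k, Nat.find hex = k + 1 := by
      refine Nat.exists_eq_succ_of_ne_zero fun h0 ↦ ?_
      have := Nat.find_spec hex
      rw [h0] at this
      simp only [Nat.cast_zero, zero_mul, add_zero] at this
      exact hxm.1.not_ge this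
    have hk1 : x ≤ a + (k + 1 : ℕ) * d := hk ▸ Nat.find_spec hex
    have hk2 : a + k * d < x := not_le.1 (Nat.find_min hex (by omega))
    have hkm : k < ⌈c / d⌉₊ := by
      have : Nat.find hex ≤ ⌈c / d⌉₊ :=
        Nat.find_min' hex (hxm.2.trans (by gcongr; exact (NNReal.ceil_div_mul_spec hd0).1))
      omega
    rw [Finset.sum_eq_single_of_mem k (Finset.mem_range.2 hkm), if_pos ⟨hk2, hk1⟩, Real.dist_eq]
    · simp only [hD]
      rw [hnext] at hk1 ⊢
      exact hd _ hk2 hk1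
    · intro i _ hik
      refine if_neg fun h ↦ ?_
      rcases lt_or_gt_of_ne hik with h1 | h1
      · exact (hk2.trans_le h.2).not_ge (hmonot _ _ h1)
      · exact (h.1.trans_le hk1).not_ge (hmonot _ _ h1)
  -- The limit is that of the telescoping sum minus the increments of the cells with large jumps;
  -- for small `d` this equals the cut sum term by term.
  have hlim := (hend.sub_const (u a)).sub (tendsto_finsetSum J hjump)
  refine hlim.congr' ?_
  filter_upwards [hmod, hbig, hsep, hafter, self_mem_nhdsWithin]
    with d hmod hbig hsep hafter (hd0 : 0 < d)
  have htel : u (a + ⌈c / d⌉₊ * d) - u a = ∑ i ∈ Finset.range ⌈c / d⌉₊, D d i := by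
    rw [Finset.sum_range_sub (fun i ↦ u (a + i * d))]
    simp
  rw [htel, Finset.sum_comm, ← Finset.sum_sub_distrib]
  refine Finset.sum_congr rfl fun i hi ↦ ?_
  have hi' : a + i * d ≤ a + c := by
    gcongr
    exact ((NNReal.ceil_div_mul_spec hd0).2.2 i (Finset.mem_range.1 hi)).le
  simp only [hD, hnext]
  by_cases hx : ∃ x ∈ J, a + i * d < x ∧ x ≤ a + i * d + d
  · obtain ⟨x, hxJ, hx⟩ := hx
    rw [Finset.sum_eq_single_of_mem x hxJ, if_pos hx, sub_self,
      cut_of_le (hbig x hxJ _ hx.1 hx.2)]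
    intro y hy hyx
    exact if_neg fun h ↦ hyx (hsep y hy x hxJ _ h.1 h.2 hx.1 hx.2)
  · push Not at hx
    rw [Finset.sum_eq_zero fun x hxJ ↦ if_neg fun h ↦ (hx x hxJ h.1).not_ge h.2, sub_zero,
      cut_of_lt]
    refine hmod _ hi' fun x hxm ↦ ?_
    rcases le_or_gt x (a + c) with h | h
    · by_contra hge
      have hxJ := (hJ x).2 ⟨⟨le_self_add.trans_lt hxm.1, h⟩, not_lt.1 hge⟩
      exact (hx x hxJ hxm.1).not_ge hxm.2
    · exact hafter x ⟨h, hxm.2.trans (by gcongr)⟩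

/-! ### From the grid to continuous time -/

/-- Fatou's lemma for sets, with no measurability needed: continuity from below holds for increasing
unions of arbitrary sets. -/
theorem MeasureTheory.measure_le_of_ae_eventually_mem {Ω : Type*} [MeasurableSpace Ω]
    {P : Measure Ω} {A : ℕ → Set Ω} {E : Set Ω} {c : ℝ≥0∞} (hA : ∀ k, P (A k) ≤ c)
    (hE : ∀ᵐ ω ∂P, ω ∈ E → ∀ᶠ k in atTop, ω ∈ A k) : P E ≤ c := by
  have hmono : Monotone fun m ↦ ⋂ k, ⋂ (_ : m ≤ k), A k := fun m m' h ↦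
    iInter_mono fun k ↦ iInter_mono' fun h' ↦ ⟨h.trans h', subset_rfl⟩
  calc P E ≤ P (⋃ m, ⋂ k, ⋂ (_ : m ≤ k), A k) := by
        refine measure_mono_ae ?_
        filter_upwards [hE] with ω h hω
        obtain ⟨m, hm⟩ := eventually_atTop.1 (h hω)
        exact mem_iUnion.2 ⟨m, mem_iInter₂.2 hm⟩
    _ = ⨆ m, P (⋂ k, ⋂ (_ : m ≤ k), A k) := hmono.measure_iUnion
    _ ≤ c := iSup_le fun m ↦
        (measure_mono (iInter₂_subset (s := fun k (_ : m ≤ k) ↦ A k) m le_rfl)).trans (hA m)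

theorem IsStdSymmetricStable.measure_lt_iSup_truncate_le {Ω : Type*} [MeasurableSpace Ω]
    {P : Measure Ω} [IsProbabilityMeasure P] {α : ℝ} {S : ℝ≥0 → Ω → ℝ}
    (hS : IsStdSymmetricStable α S P) (hα : α < 2) (a : ℝ≥0) {h : ℝ≥0} (hh : 0 < h) {δ l r : ℝ}
    (hδ : 0 < δ) (hl0 : 0 ≤ l) (hl : l * δ ≤ 1) (hr : 0 ≤ r) :
    P {ω | ENNReal.ofReal r < ⨆ t ∈ Ioc a (a + h),
        ENNReal.ofReal |truncate (fun s ↦ S s ω) δ t - truncate (fun s ↦ S s ω) δ a|} ≤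
      2 * ENNReal.ofReal (Real.exp (3 * l ^ 2 * δ ^ (2 - α) * h - l * r)) := by
  obtain ⟨δs, -, hδs, hδlim⟩ := exists_seq_strictMono_tendsto' hδ
  have hδlim' : Tendsto δs atTop (𝓝[<] δ) :=
    tendsto_nhdsWithin_iff.2 ⟨hδlim, Eventually.of_forall fun k ↦ (hδs k).2⟩
  set d : ℕ → ℝ≥0 := fun N ↦ h / ((N + 1 : ℕ) : ℝ≥0) with hd
  have hd0 : ∀ N, 0 < d N := fun N ↦ by positivity
  have hNd : ∀ N, ((N + 1 : ℕ) : ℝ≥0) * d N = h := fun N ↦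
    mul_div_cancel₀ h (by positivity : ((N + 1 : ℕ) : ℝ≥0) ≠ 0)
  have hdlim : Tendsto d atTop (𝓝[>] 0) := by
    refine tendsto_nhdsWithin_iff.2 ⟨?_, Eventually.of_forall hd0⟩
    exact (tendsto_const_div_atTop_nhds_zero_nat h).comp (tendsto_add_atTop_nat 1)
  set A : ℕ → ℕ → Set Ω := fun k N ↦ {ω | ∃ m ≤ N + 1, r < |∑ i ∈ Finset.range m,
    cut (δs k) (S (a + (i + 1 : ℕ) * d N) ω - S (a + i * d N) ω)|} with hA
  have hAle : ∀ k N, P (A k N) ≤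
      2 * ENNReal.ofReal (Real.exp (3 * l ^ 2 * δ ^ (2 - α) * h - l * r)) := fun k N ↦ by
    refine (hS.measure_exists_lt_abs_sum_cut_le a (d N) (hδs k).1 hl0
      ((mul_le_mul_of_nonneg_left (hδs k).2.le hl0).trans hl) hr N).trans ?_
    rw [hNd]
    have hpow : δs k ^ (2 - α) ≤ δ ^ (2 - α) :=
      Real.rpow_le_rpow (hδs k).1.le (hδs k).2.le (by linarith)
    gcongr
  -- Fatou is used twice: the mesh goes to 0 at a fixed cut level, and the levels `δs k` increase to
  -- `δ`.
  refine measure_le_of_ae_eventually_mem (A := fun k ↦ {ω | ∀ᶠ N in atTop, ω ∈ A k N})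
    (fun k ↦ measure_le_of_ae_eventually_mem (hAle k) (ae_of_all _ fun ω hω ↦ hω)) ?_
  filter_upwards [hS.levy.cadlag] with ω hω hlt
  simp only [lt_iSup_iff] at hlt
  obtain ⟨t, ht, hlt⟩ := hlt
  obtain ⟨c, rfl⟩ := exists_add_of_le ht.1.le
  have hch : c ≤ h := by simpa using ht.2
  have hlt' := (ENNReal.ofReal_lt_ofReal_iff_of_nonneg hr).1 hlt
  filter_upwards [hδlim'.eventually (hω.tendsto_sum_cut a c hδ)] with k hk
  have hlim := (hk.comp hdlim).abs
  filter_upwards [hlim.eventually (lt_mem_nhds hlt')] with N hN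
  -- Since `c ≤ h = (N + 1) * d N`, one event about partial sums serves every `t`, so the
  -- uncountable supremum costs nothing.
  refine ⟨⌈c / d N⌉₊, ?_, hN⟩
  rw [Nat.ceil_le, div_le_iff₀ (hd0 N), hNd]
  exact hch

/-! ### Choice of parameters and summation -/

/-- Since `exp y ≥ y^K / K!`, taking `K ≥ 3 / ε` makes the exponential factor at most `K! 8^(-n)`,
leaving a geometric series of ratio `1/2`. -/
theorem summable_four_pow_mul_exp_neg {ε : ℝ} (hε : 0 < ε) :
    Summable fun n : ℕ ↦ (4 : ℝ) ^ n * Real.exp (-(2 : ℝ) ^ (n * ε)) := by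
  obtain ⟨K, hK⟩ := exists_nat_ge (3 / ε)
  have hK' : 3 ≤ ε * K := by rwa [div_le_iff₀ hε, mul_comm] at hK
  refine Summable.of_nonneg_of_le (fun n ↦ by positivity) (fun n ↦ ?_)
    ((summable_geometric_of_lt_one (r := (1 / 2 : ℝ)) (by norm_num) (by norm_num)).mul_left
      (K.factorial : ℝ))
  have h1 := Real.pow_div_factorial_le_exp ((2 : ℝ) ^ (n * ε)) (by positivity) K
  have h2 : (8 : ℝ) ^ n ≤ ((2 : ℝ) ^ (n * ε)) ^ K := by
    rw [← Real.rpow_natCast _ K, ← Real.rpow_mul (by norm_num), mul_assoc, mul_comm,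
      Real.rpow_mul (by norm_num), Real.rpow_natCast]
    gcongr
    calc (8 : ℝ) = (2 : ℝ) ^ (3 : ℝ) := by norm_num
      _ ≤ _ := Real.rpow_le_rpow_of_exponent_le (by norm_num) hK'
  rw [div_le_iff₀ (by positivity)] at h1
  rw [Real.exp_neg, ← div_eq_mul_inv, div_le_iff₀ (Real.exp_pos _)]
  have h3 : (8 : ℝ) ^ n * (1 / 2) ^ n = 4 ^ n := by rw [← mul_pow]; norm_num
  rw [← h3]
  nlinarith [mul_le_mul_of_nonneg_right (h2.trans h1) (by positivity : (0 : ℝ) ≤ (1 / 2) ^ n)]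

theorem IsStdSymmetricStable.measure_oscEvent_le {Ω : Type*} [MeasurableSpace Ω]
    {P : Measure Ω} [IsProbabilityMeasure P] {α β ε : ℝ} {S : ℝ≥0 → Ω → ℝ}
    (hS : IsStdSymmetricStable α S P) (hα : α < 2) (hβ : 1 < β) (hεβ : 1 + ε ≤ β)
    (hεα : 2 * ε ≤ 2 - α) (n j : ℕ) :
    P (oscEvent S β n j) ≤ 2 * ENNReal.ofReal (Real.exp (3 - (2 : ℝ) ^ (n * ε))) := by
  have h2 : (0 : ℝ) < 2 := by norm_num
  have hn : (0 : ℝ) ≤ n := n.cast_nonneg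
  have hset : ((j : ℝ≥0) + 1) / 2 ^ (2 * n) = (j : ℝ≥0) / 2 ^ (2 * n) + 1 / 2 ^ (2 * n) :=
    add_div _ _ _
  rw [oscEvent, hset]
  -- With this `l`, `1 + ε ≤ β` gives `l * δ ≤ 1`, `2 ε ≤ β (2 - α)` gives `l² δ^(2-α) h ≤ 1`, and
  -- `l r = 2^(nε)`.
  refine (hS.measure_lt_iSup_truncate_le hα _ (by positivity)
    (l := (2 : ℝ) ^ (n * (1 + ε))) (by positivity) (by positivity) ?_ (by positivity)).trans ?_
  · rw [← Real.rpow_add h2]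
    refine Real.rpow_le_one_of_one_le_of_nonpos (by norm_num) ?_
    nlinarith
  · have hh : (((1 / 2 ^ (2 * n) : ℝ≥0)) : ℝ) = (2 : ℝ) ^ (-(2 * n : ℝ)) := by
      rw [Real.rpow_neg h2.le, show (2 * n : ℝ) = ((2 * n : ℕ) : ℝ) by push_cast; rfl,
        Real.rpow_natCast]
      simp
    have h3 : ((2 : ℝ) ^ (n * (1 + ε))) ^ 2 * ((2 : ℝ) ^ (-(β * n))) ^ (2 - α) *
        (2 : ℝ) ^ (-(2 * n : ℝ)) ≤ 1 := by
      rw [← Real.rpow_natCast _ 2, ← Real.rpow_mul h2.le, ← Real.rpow_mul h2.le,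
        ← Real.rpow_add h2, ← Real.rpow_add h2]
      refine Real.rpow_le_one_of_one_le_of_nonpos (by norm_num) ?_
      have h4 : 2 * ε ≤ β * (2 - α) := by nlinarith
      push_cast
      nlinarith [mul_le_mul_of_nonneg_left h4 hn]
    have h5 : (2 : ℝ) ^ (n * (1 + ε)) * (2 : ℝ) ^ (-(n : ℝ)) = (2 : ℝ) ^ (n * ε) := by
      rw [← Real.rpow_add h2]
      ring_nf
    rw [hh, h5]
    gcongr
    linarith

theorem lemma3p2 {Ω : Type*} [MeasurableSpace Ω] (P : Measure Ω) [IsProbabilityMeasure P]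
    (α β : ℝ) (hα0 : 0 < α) (hα2 : α < 2) (hβ : 1 < β)
    (S : ℝ≥0 → Ω → ℝ) (hS : IsStdSymmetricStable α S P) :
    Tendsto
      (fun m : ℕ ↦ P (⋃ (n : ℕ) (_ : m ≤ n) (j : ℕ) (_ : (j : ℤ) < 2 ^ (2 * n) - 1),
        oscEvent S β n j))
      atTop (𝓝 0) := by
  set ε : ℝ := min (β - 1) ((2 - α) / 2) with hε
  have hε0 : 0 < ε := lt_min (by linarith) (by linarith)
  have hεβ : 1 + ε ≤ β := by linarith [min_le_left (β - 1) ((2 - α) / 2)]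
  have hεα : 2 * ε ≤ 2 - α := by linarith [min_le_right (β - 1) ((2 - α) / 2)]
  set f : ℕ → ℝ := fun n ↦ 2 * Real.exp 3 * ((4 : ℝ) ^ n * Real.exp (-(2 : ℝ) ^ (n * ε))) with hf
  have hsum : Summable f := (summable_four_pow_mul_exp_neg hε0).mul_left _
  have hlim : Tendsto (fun m ↦ ∑' k, ENNReal.ofReal (f (k + m))) atTop (𝓝 0) :=
    ENNReal.tendsto_sum_nat_add (fun n ↦ ENNReal.ofReal (f n)) hsum.tsum_ofReal_ne_top
  refine tendsto_of_tendsto_of_tendsto_of_le_of_le tendsto_const_nhds hlim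
    (fun _ ↦ zero_le) fun m ↦ ?_
  -- Enlarging the range of `j` to `j < 4^n` is harmless for the union bound.
  have hsub : (⋃ (n : ℕ) (_ : m ≤ n) (j : ℕ) (_ : (j : ℤ) < 2 ^ (2 * n) - 1),
      oscEvent S β n j) ⊆ ⋃ k, ⋃ j ∈ Finset.range (4 ^ (k + m)), oscEvent S β (k + m) j := by
    simp only [iUnion_subset_iff]
    intro n hn j hj
    obtain ⟨k, rfl⟩ := exists_add_of_le hn
    rw [add_comm m k] at hj ⊢
    have hj' : j < 4 ^ (k + m) := by
      rw [pow_mul] at hj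
      have : (j : ℤ) < ((4 ^ (k + m) : ℕ) : ℤ) := by push_cast; norm_num at hj; linarith
      exact_mod_cast this
    exact (subset_biUnion_of_mem (u := fun j ↦ oscEvent S β (k + m) j)
      (s := (Finset.range (4 ^ (k + m)) : Set ℕ)) (by simpa using hj')).trans
      (subset_iUnion (fun k ↦ ⋃ j ∈ Finset.range (4 ^ (k + m)), oscEvent S β (k + m) j) k)
  refine (measure_mono hsub).trans ((measure_iUnion_le _).trans (ENNReal.tsum_le_tsum fun k ↦ ?_))
  refine (measure_biUnion_finset_le _ _).trans ((Finset.sum_le_sum fun j _ ↦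
    hS.measure_oscEvent_le hα2 hβ hεβ hεα (k + m) j).trans (le_of_eq ?_))
  rw [Finset.sum_const, Finset.card_range, nsmul_eq_mul, hf, sub_eq_add_neg, Real.exp_add]
  have h4 : ((4 ^ (k + m) : ℕ) : ℝ≥0∞) = ENNReal.ofReal (4 ^ (k + m)) := by
    rw [← ENNReal.ofReal_natCast]; push_cast; rfl
  have h2 : (2 : ℝ≥0∞) = ENNReal.ofReal 2 := by simp
  rw [h4, h2, ← ENNReal.ofReal_mul (by norm_num), ← ENNReal.ofReal_mul (by positivity)]
  congr 1
  ring
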